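/- Let $\mathbb{F}_q$ be a finite field and let $\mathcal{C}\subseteq\mathbb{F}_q^n$ be a linear code. For a word $\mathbf{a}\in\mathbb{F}_q^n$ let $\operatorname{supp}(\mathbf{a})=\{i : a_i\neq 0\}$ and let $w(\mathbf{a})=|\operatorname{supp}(\mathbf{a})|$ be its Hamming weight. For a subspace $D\subseteq\mathbb{F}_q^n$ let $w(D)=|\bigcup_{\mathbf{c}\in D}\operatorname{supp}(\mathbf{c})|$, and let $d_r(\mathcal{C})=\min\{w(D) : D\subseteq\mathcal{C} \text{ a subspace},\ \dim D=r\}$ be the $r$-th generalized Hamming weight. A nonzero codeword of $\mathcal{C}$ has minimal support if its support does not properly contain the support of any other nonzero codeword. Let $M$ be a set of codewords of $\mathcal{C}$ of minimal support, and suppose that the set $S_M=\{\operatorname{supp}(\mathbf{c}) : \mathbf{c}\in M\}$ has at least two elements. Let $K$ be any field, let $R=K[x_1,\dots,x_n]$ with the standard grading, and let $I_M\subseteq R$ be the ideal generated by the monomials $\prod_{i\in\sigma}x_i$, $\sigma\in S_M$. Then $R/I_M$ has a minimal graded free resolution $\cdots\to F_2\to F_1\to F_0\to R/I_M\to 0$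 with all $F_i=\bigoplus_{j} R(-j)^{\beta_{i,j}(R/I_M)}$ of finite rank, and for every such resolution the following holds. 1. $\min\{j : \beta_{1,j}(R/I_M)\neq 0\}=d_1(\mathcal{C})$ if and only if $M$ contains a codeword of minimum Hamming weight, that is, of weight $\min\{w(\mathbf{a}) : \mathbf{0}\neq\mathbf{a}\in\mathcal{C}\}$. 2. $\min\{j : \beta_{2,j}(R/I_M)\neq 0\}=d_2(\mathcal{C})$ if and only if $M$ is a $d_2$-test set of $\mathcal{C}$, that is, there are $\mathbf{c}_1,\mathbf{c}_2\in M$ such that $\dim\langle\mathbf{c}_1,\mathbf{c}_2\rangle=2$ and $w(\langle\mathbf{c}_1,\mathbf{c}_2\rangle)=d_2(\mathcal{C})$. -/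

import Mathlib

open scoped Classical in
/-- The support of a word. -/
noncomputable def wordSupport {F : Type*} [Field F] {n : ℕ} (c : Fin n → F) : Finset (Fin n) :=
  Finset.univ.filter fun i => c i ≠ 0

/-- The Hamming weight of a word: the cardinality of its support. -/
noncomputable def wordWeight {F : Type*} [Field F] {n : ℕ} (c : Fin n → F) : ℕ :=
  (wordSupport c).card

/-- The minimum Hamming weight of a nonzero codeword of `C`. -/
noncomputable def minimumWeight {F : Type*} [Field F] {n : ℕ}
    (C : Submodule F (Fin n → F)) : ℕ :=
  sInf {w | ∃ a ∈ C, a ≠ 0 ∧ wordWeight a = w}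

/-- The support of a space of words: the positions where some word of it is nonzero. -/
def spaceSupport {F : Type*} [Field F] {n : ℕ} (D : Submodule F (Fin n → F)) : Set (Fin n) :=
  {i | ∃ c ∈ D, i ∈ wordSupport c}

/-- The weight of a space of words. -/
noncomputable def spaceWeight {F : Type*} [Field F] {n : ℕ}
    (D : Submodule F (Fin n → F)) : ℕ :=
  (spaceSupport D).ncard

/-- The `r`-th generalized Hamming weight of `C` (meaningful for `r ≤ dim C`). -/
noncomputable def generalizedHammingWeight {F : Type*} [Field F] {n : ℕ}
    (C : Submodule F (Fin n → F)) (r : ℕ) : ℕ :=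
  sInf {w | ∃ D : Submodule F (Fin n → F), D ≤ C ∧ Module.finrank F D = r ∧ spaceWeight D = w}

/-- The nonzero codewords of minimal support. -/
def minimalSupportCodewords {F : Type*} [Field F] {n : ℕ}
    (C : Submodule F (Fin n → F)) : Set (Fin n → F) :=
  {c | c ∈ C ∧ c ≠ 0 ∧ ∀ c' ∈ C, c' ≠ 0 → ¬ wordSupport c' ⊂ wordSupport c}

/-- `M` is a `d₂`-test set of `C`. -/
def IsD2TestSet {F : Type*} [Field F] {n : ℕ}
    (C : Submodule F (Fin n → F)) (M : Set (Fin n → F)) : Prop :=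
  M ⊆ minimalSupportCodewords C ∧
    ∃ c₁ ∈ M, ∃ c₂ ∈ M,
      Module.finrank F (Submodule.span F {c₁, c₂}) = 2 ∧
        spaceWeight (Submodule.span F {c₁, c₂}) = generalizedHammingWeight C 2

/-- The set `S_M` of supports of the words in `M`. -/
def supportSet {F : Type*} [Field F] {n : ℕ} (M : Set (Fin n → F)) : Set (Finset (Fin n)) :=
  {σ | ∃ c ∈ M, wordSupport c = σ}

/-- The squarefree monomial ideal `I_M` of `K[x₁, …, xₙ]` generated by the monomials `x^σ`,
`σ ∈ S_M`. -/
noncomputable def supportIdeal (K : Type*) [Field K] {F : Type*} [Field F] {n : ℕ}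
    (M : Set (Fin n → F)) : Ideal (MvPolynomial (Fin n) K) :=
  Ideal.span {f | ∃ σ ∈ supportSet M, f = ∏ i ∈ σ, MvPolynomial.X i}

/-- An element `v` of the graded free module `⨁ₐ R(-deg a)` is homogeneous of degree `j`:
each component `v a` is a homogeneous polynomial of degree `j - deg a` (zero if `j < deg a`). -/
def IsHomogeneousVector {K : Type*} [Field K] {n r : ℕ} (deg : Fin r → ℕ)
    (v : Fin r → MvPolynomial (Fin n) K) (j : ℕ) : Prop :=
  ∀ a, ∀ m : Fin n →₀ ℕ, (v a).coeff m ≠ 0 → m.degree + deg a = j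

/-- A minimal graded free resolution
`⋯ → F₂ → F₁ → F₀ → R/I → 0` of `R/I`, `R = K[x₁, …, xₙ]` with the standard grading,
where `Fᵢ = ⨁ₐ R(-degree i a)` is a graded free module of finite rank `rank i`. -/
structure MinimalGradedFreeResolution {K : Type*} [Field K] {n : ℕ}
    (I : Ideal (MvPolynomial (Fin n) K)) where
  /-- the rank of `Fᵢ` -/
  rank : ℕ → ℕ
  /-- the degrees of the basis elements of `Fᵢ` -/
  degree : ∀ i, Fin (rank i) → ℕ
  /-- the augmentation `F₀ → R/I` -/
  aug : (Fin (rank 0) → MvPolynomial (Fin n) K) →ₗ[MvPolynomial (Fin n) K]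
    MvPolynomial (Fin n) K ⧸ I
  /-- the differential `Fᵢ₊₁ → Fᵢ` -/
  d : ∀ i, (Fin (rank (i + 1)) → MvPolynomial (Fin n) K) →ₗ[MvPolynomial (Fin n) K]
    (Fin (rank i) → MvPolynomial (Fin n) K)
  /-- the augmentation preserves degrees -/
  aug_homogeneous : ∀ v j, IsHomogeneousVector (degree 0) v j →
    ∃ f : MvPolynomial (Fin n) K, f.IsHomogeneous j ∧ aug v = Ideal.Quotient.mk I f
  /-- the differentials preserve degrees -/
  d_homogeneous : ∀ i v j, IsHomogeneousVector (degree (i + 1)) v j →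
    IsHomogeneousVector (degree i) (d i v) j
  /-- exactness at `R/I` -/
  aug_surjective : Function.Surjective aug
  /-- exactness at `F₀` -/
  exact_zero : Function.Exact (d 0) aug
  /-- exactness at `Fᵢ₊₁` -/
  exact_succ : ∀ i, Function.Exact (d (i + 1)) (d i)
  /-- minimality: the image of `Fᵢ₊₁` lies in `(x₁, …, xₙ) Fᵢ` -/
  minimal : ∀ i v a, d i v a ∈ MvPolynomial.idealOfVars (Fin n) K

/-- The graded Betti number `β_{i,j}`: the number of summands `R(-j)` of `Fᵢ`. -/
def MinimalGradedFreeResolution.betti {K : Type*} [Field K] {n : ℕ}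
    {I : Ideal (MvPolynomial (Fin n) K)} (𝓕 : MinimalGradedFreeResolution I) (i j : ℕ) : ℕ :=
  (Finset.univ.filter fun a : Fin (𝓕.rank i) => 𝓕.degree i a = j).card

/-! In a minimal graded resolution, the least degree of a generator of F_{i+1} is the least degree
of a nonzero homogeneous element of its image in F_i (`isLeast_betti_succ_iff`). Only the image of
F₁ in F₀ and the syzygies of F₁ → F₀ therefore matter.

By minimality F₀ is R in degree 0, and the image of F₁ is I_M, so β₁ starts at the least |σ|. The
supports form an antichain, so the monomials x^σ give a minimal presentation of I_M, and least
syzygy degrees agree for all minimal presentations. A syzygy must cancel a multiple of some x^σ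
against one of another x^τ, hence has degree at least |σ ∪ τ|; the pair syzygies attain this. So β₂
starts at the least |σ ∪ τ| with σ ≠ τ.

On the coding side, two words of minimal support span a plane exactly when their supports differ,
and |σ ∪ τ| is the weight of that plane. The initial degrees are thus bounded below by d₁ and d₂,
and equality means that M attains them. Existence of a resolution comes from iterating minimal
homogeneous generation of syzygies over a Noetherian ring. -/

open MvPolynomial

/-! ### Graded free modules and homogeneous maps -/

section HomogeneousVectors

variable {K : Type*} [Field K] {n r s t : ℕ}

theorem mem_idealOfVars_iff_constantCoeff (p : MvPolynomial (Fin n) K) :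
    p ∈ idealOfVars (Fin n) K ↔ constantCoeff p = 0 := by
  have h := mem_pow_idealOfVars_iff' (σ := Fin n) (R := K) 1 p
  rw [pow_one] at h
  rw [h, constantCoeff_eq]
  constructor
  · intro h
    exact h 0 (by simp)
  · intro h x hx
    have : x = 0 := by
      rw [← Finsupp.degree_eq_zero_iff]
      omega
    rwa [this]

theorem IsHomogeneousVector.smul_of_isHomogeneous {deg : Fin r → ℕ}
    {v : Fin r → MvPolynomial (Fin n) K} {i j : ℕ} {p : MvPolynomial (Fin n) K}
    (hp : p.IsHomogeneous i) (hv : IsHomogeneousVector deg v j) :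
    IsHomogeneousVector deg (p • v) (i + j) := by
  classical
  intro a m hm
  rw [Pi.smul_apply, smul_eq_mul, coeff_mul] at hm
  obtain ⟨⟨x, y⟩, hxy, hne⟩ := Finset.exists_ne_zero_of_sum_ne_zero hm
  have hx := hp.degree_eq_sum_deg_support (mem_support_iff.2 (left_ne_zero_of_mul hne))
  have hy := hv a y (right_ne_zero_of_mul hne)
  rw [Finset.HasAntidiagonal.mem_antidiagonal] at hxy
  rw [← hxy, map_add]
  have hx' : x.degree = i := by rw [hx, Finsupp.degree_apply]
  simp only at *
  omega

theorem IsHomogeneousVector.add {deg : Fin r → ℕ}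
    {v w : Fin r → MvPolynomial (Fin n) K} {j : ℕ}
    (hv : IsHomogeneousVector deg v j) (hw : IsHomogeneousVector deg w j) :
    IsHomogeneousVector deg (v + w) j := by
  intro a m hm
  by_cases h : (v a).coeff m = 0
  · refine hw a m fun h' => hm ?_
    simp [h, h']
  · exact hv a m h

theorem IsHomogeneousVector.zero (deg : Fin r → ℕ) (j : ℕ) :
    IsHomogeneousVector deg (0 : Fin r → MvPolynomial (Fin n) K) j := by
  intro a m hm
  simp at hm

theorem IsHomogeneousVector.sum {deg : Fin r → ℕ} {ι : Type*} (S : Finset ι)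
    {v : ι → Fin r → MvPolynomial (Fin n) K} {j : ℕ}
    (hv : ∀ i ∈ S, IsHomogeneousVector deg (v i) j) :
    IsHomogeneousVector deg (∑ i ∈ S, v i) j := by
  classical
  exact Finset.sum_induction _ (IsHomogeneousVector deg · j) (fun _ _ => .add)
    (IsHomogeneousVector.zero deg j) hv

theorem isHomogeneousVector_single (deg : Fin r → ℕ) (a : Fin r) :
    IsHomogeneousVector deg (Pi.single a (1 : MvPolynomial (Fin n) K)) (deg a) := by
  classical
  intro b m hm
  by_cases h : b = a
  · subst h
    rw [Pi.single_eq_same, coeff_one] at hm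
    have : m = 0 := by
      by_contra h0
      exact hm (if_neg (Ne.symm h0))
    simp [this]
  · simp [Pi.single_eq_of_ne h] at hm

/-- The component of degree `j` of a vector in the graded free module `⨁ₐ R(-deg a)`. -/
noncomputable def vectorComponent (K : Type*) [Field K] (n : ℕ) (deg : Fin r → ℕ) (j : ℕ) :
    (Fin r → MvPolynomial (Fin n) K) →+ (Fin r → MvPolynomial (Fin n) K) where
  -- Without the guard, truncated subtraction would return the constant term of `v a` when `j < deg
  -- a`.
  toFun v a := if deg a ≤ j then homogeneousComponent (j - deg a) (v a) else 0
  map_zero' := by ext; simp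
  map_add' v w := by
    funext a
    simp only [Pi.add_apply]
    split_ifs <;> simp

theorem coeff_vectorComponent (deg : Fin r → ℕ) (j : ℕ) (v : Fin r → MvPolynomial (Fin n) K)
    (a : Fin r) (m : Fin n →₀ ℕ) :
    (vectorComponent K n deg j v a).coeff m =
      if m.degree + deg a = j then (v a).coeff m else 0 := by
  change coeff m (if deg a ≤ j then homogeneousComponent (j - deg a) (v a) else 0) = _
  by_cases h : deg a ≤ j
  · rw [if_pos h, coeff_homogeneousComponent]
    exact if_congr (by omega) rfl rfl
  · rw [if_neg h, if_neg (by omega), coeff_zero]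

theorem isHomogeneousVector_vectorComponent (deg : Fin r → ℕ) (j : ℕ)
    (v : Fin r → MvPolynomial (Fin n) K) :
    IsHomogeneousVector deg (vectorComponent K n deg j v) j := by
  intro a m hm
  rw [coeff_vectorComponent] at hm
  by_contra h
  exact hm (if_neg h)

theorem IsHomogeneousVector.vectorComponent_eq {deg : Fin r → ℕ} {i j : ℕ}
    {v : Fin r → MvPolynomial (Fin n) K} (hv : IsHomogeneousVector deg v i) :
    vectorComponent K n deg j v = if i = j then v else 0 := by
  funext a
  ext m
  rw [coeff_vectorComponent]
  by_cases h : (v a).coeff m = 0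
  · split_ifs <;> simp [h]
  · have := hv a m h
    subst this
    split_ifs <;> simp

theorem exists_sum_vectorComponent_eq (deg : Fin r → ℕ) (v : Fin r → MvPolynomial (Fin n) K) :
    ∃ N, v = ∑ j ∈ Finset.range N, vectorComponent K n deg j v := by
  refine ⟨Finset.univ.sup (fun a => (v a).totalDegree + deg a) + 1, ?_⟩
  funext a
  ext m
  simp only [Finset.sum_apply, coeff_sum, coeff_vectorComponent]
  rw [Finset.sum_ite_eq]
  split_ifs with h
  · rfl
  · by_contra hm
    apply h
    rw [Finset.mem_range, Nat.lt_succ_iff]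
    refine le_trans ?_ (Finset.le_sup (f := fun a => (v a).totalDegree + deg a)
      (Finset.mem_univ a))
    have := le_totalDegree (mem_support_iff.2 hm)
    rw [Finsupp.degree_apply]
    exact Nat.add_le_add_right this _

/-- A linear map of graded free modules preserving degrees. -/
def IsHomogeneousMap (deg : Fin r → ℕ) (deg' : Fin s → ℕ)
    (L : (Fin r → MvPolynomial (Fin n) K) →ₗ[MvPolynomial (Fin n) K]
      (Fin s → MvPolynomial (Fin n) K)) : Prop :=
  ∀ v j, IsHomogeneousVector deg v j → IsHomogeneousVector deg' (L v) j

theorem IsHomogeneousMap.vectorComponent_map {deg : Fin r → ℕ} {deg' : Fin s → ℕ}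
    {L : (Fin r → MvPolynomial (Fin n) K) →ₗ[MvPolynomial (Fin n) K]
      (Fin s → MvPolynomial (Fin n) K)} (hL : IsHomogeneousMap deg deg' L)
    (v : Fin r → MvPolynomial (Fin n) K) (j : ℕ) :
    vectorComponent K n deg' j (L v) = L (vectorComponent K n deg j v) := by
  obtain ⟨N, hN⟩ := exists_sum_vectorComponent_eq deg v
  conv_lhs => rw [hN]
  conv_rhs => rw [hN]
  simp only [map_sum]
  refine Finset.sum_congr rfl fun i _ => ?_
  have h := isHomogeneousVector_vectorComponent deg i v
  rw [(hL _ _ h).vectorComponent_eq, h.vectorComponent_eq]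
  split_ifs <;> simp

theorem IsHomogeneousMap.exists_preimage {deg : Fin r → ℕ} {deg' : Fin s → ℕ}
    {L : (Fin r → MvPolynomial (Fin n) K) →ₗ[MvPolynomial (Fin n) K]
      (Fin s → MvPolynomial (Fin n) K)} (hL : IsHomogeneousMap deg deg' L)
    {w : Fin s → MvPolynomial (Fin n) K} {j : ℕ} (hw : IsHomogeneousVector deg' w j)
    (hmem : w ∈ LinearMap.range L) : ∃ v, IsHomogeneousVector deg v j ∧ L v = w := by
  obtain ⟨v, rfl⟩ := hmem
  refine ⟨vectorComponent K n deg j v, isHomogeneousVector_vectorComponent _ _ _, ?_⟩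
  rw [← hL.vectorComponent_map, hw.vectorComponent_eq, if_pos rfl]

theorem isHomogeneousMap_linearCombination {deg : Fin r → ℕ} {deg' : Fin s → ℕ}
    {z : Fin r → Fin s → MvPolynomial (Fin n) K}
    (hz : ∀ a, IsHomogeneousVector deg' (z a) (deg a)) :
    IsHomogeneousMap deg deg' (Fintype.linearCombination (MvPolynomial (Fin n) K) z) := by
  intro v j hv
  rw [Fintype.linearCombination_apply]
  refine IsHomogeneousVector.sum _ fun a _ => ?_
  by_cases hj : deg a ≤ j
  · have : (v a).IsHomogeneous (j - deg a) := by
      intro m hm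
      have := hv a m hm
      have hdeg : Finsupp.weight 1 m = m.degree := by
        rw [Finsupp.degree_eq_weight_one]
        rfl
      omega
    have h := (hz a).smul_of_isHomogeneous this
    rwa [Nat.sub_add_cancel hj] at h
  · have : v a = 0 := by
      ext m
      by_contra hm
      have := hv a m hm
      omega
    rw [this, zero_smul]
    exact .zero _ _

/-- Any homogeneous map factors through any other one having a larger range. -/
theorem IsHomogeneousMap.exists_factorization {deg : Fin r → ℕ} {deg' : Fin s → ℕ}
    {deg'' : Fin t → ℕ}
    {L : (Fin r → MvPolynomial (Fin n) K) →ₗ[MvPolynomial (Fin n) K]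
      (Fin t → MvPolynomial (Fin n) K)}
    {L' : (Fin s → MvPolynomial (Fin n) K) →ₗ[MvPolynomial (Fin n) K]
      (Fin t → MvPolynomial (Fin n) K)}
    (hL : IsHomogeneousMap deg deg'' L) (hL' : IsHomogeneousMap deg' deg'' L')
    (hle : LinearMap.range L ≤ LinearMap.range L') :
    ∃ Q : (Fin r → MvPolynomial (Fin n) K) →ₗ[MvPolynomial (Fin n) K]
      (Fin s → MvPolynomial (Fin n) K), IsHomogeneousMap deg deg' Q ∧ ∀ v, L' (Q v) = L v := by
  classical
  have h : ∀ a, ∃ u, IsHomogeneousVector deg' u (deg a) ∧ L' u = L (Pi.single a 1) := fun a =>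
    hL'.exists_preimage (hL _ _ (isHomogeneousVector_single deg a)) (hle ⟨_, rfl⟩)
  choose u hu hLu using h
  refine ⟨Fintype.linearCombination _ u, isHomogeneousMap_linearCombination hu, fun v => ?_⟩
  rw [Fintype.linearCombination_apply, map_sum]
  conv_rhs => rw [pi_eq_sum_univ' v, map_sum]
  refine Finset.sum_congr rfl fun a _ => ?_
  rw [map_smul, map_smul, hLu]

/-- An endomorphism congruent to the identity modulo the irrelevant ideal is injective. -/
theorem eq_zero_of_apply_eq_zero_of_constantCoeff_eq
    (L : (Fin r → MvPolynomial (Fin n) K) →ₗ[MvPolynomial (Fin n) K]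
      (Fin r → MvPolynomial (Fin n) K))
    (h : ∀ v a, constantCoeff (L v a) = constantCoeff (v a))
    {v : Fin r → MvPolynomial (Fin n) K} (hv : L v = 0) : v = 0 := by
  classical
  -- Modulo the variables the matrix is the identity, so its determinant has constant term 1 and is
  -- nonzero in a domain.
  have hmap : (LinearMap.toMatrix' L).map constantCoeff = (1 : Matrix (Fin r) (Fin r) K) := by
    ext a b
    rw [Matrix.map_apply, LinearMap.toMatrix'_apply, h, Matrix.one_apply, Pi.single_apply]
    split_ifs <;> simp
  have hdet : (LinearMap.toMatrix' L).det ≠ 0 := by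
    intro h0
    have := congrArg constantCoeff h0
    rw [RingHom.map_det, RingHom.mapMatrix_apply, hmap] at this
    simp at this
  refine Matrix.eq_zero_of_mulVec_eq_zero hdet ?_
  rw [LinearMap.toMatrix'_mulVec, hv]

/-- The degrees of nonzero syzygies do not depend on the minimal presentation. -/
theorem IsHomogeneousMap.exists_mem_ker_of_range_eq {deg : Fin r → ℕ} {deg' : Fin s → ℕ}
    {deg'' : Fin t → ℕ}
    {L : (Fin r → MvPolynomial (Fin n) K) →ₗ[MvPolynomial (Fin n) K]
      (Fin t → MvPolynomial (Fin n) K)}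
    {L' : (Fin s → MvPolynomial (Fin n) K) →ₗ[MvPolynomial (Fin n) K]
      (Fin t → MvPolynomial (Fin n) K)}
    (hL : IsHomogeneousMap deg deg'' L) (hL' : IsHomogeneousMap deg' deg'' L')
    (heq : LinearMap.range L = LinearMap.range L')
    (hmin : ∀ v, L v = 0 → ∀ a, constantCoeff (v a) = 0) {j : ℕ}
    (h : ∃ v ≠ 0, IsHomogeneousVector deg v j ∧ L v = 0) :
    ∃ v ≠ 0, IsHomogeneousVector deg' v j ∧ L' v = 0 := by
  obtain ⟨v, hv0, hvj, hv⟩ := h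
  obtain ⟨Q, hQ, hLQ⟩ := hL.exists_factorization hL' heq.le
  obtain ⟨P, hP, hLP⟩ := hL'.exists_factorization hL heq.ge
  refine ⟨Q v, fun h0 => hv0 ?_, hQ _ _ hvj, by rw [hLQ, hv]⟩
  -- `P ∘ Q - id` takes values in the kernel of `L`, where constant coefficients vanish; hence `P ∘
  -- Q` is injective and `Q v ≠ 0`.
  refine eq_zero_of_apply_eq_zero_of_constantCoeff_eq (P ∘ₗ Q) (fun w a => ?_) (by simp [h0])
  have := hmin (P (Q w) - w) (by rw [map_sub, hLP, hLQ, sub_self]) a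
  rwa [Pi.sub_apply, map_sub, sub_eq_zero] at this

end HomogeneousVectors

/-! ### The first terms of a minimal resolution -/

section Resolutions

variable {K : Type*} [Field K] {n : ℕ} {I : Ideal (MvPolynomial (Fin n) K)}

/-- Allows initial degrees to be compared by inequalities alone, without determining all the degrees
that occur. -/
theorem isLeast_iff_of_mutually_coinitial {A B : Set ℕ} (hA : ∀ a ∈ A, ∃ b ∈ B, b ≤ a)
    (hB : ∀ b ∈ B, ∃ a ∈ A, a ≤ b) (d : ℕ) : IsLeast A d ↔ IsLeast B d := by
  have key : ∀ {A B : Set ℕ}, (∀ a ∈ A, ∃ b ∈ B, b ≤ a) → (∀ b ∈ B, ∃ a ∈ A, a ≤ b) →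
      IsLeast A d → IsLeast B d := by
    intro A B hA hB h
    have hlow : ∀ b ∈ B, d ≤ b := fun b hb => by
      obtain ⟨a, ha, hab⟩ := hB b hb
      exact (h.2 ha).trans hab
    obtain ⟨b, hb, hbd⟩ := hA d h.1
    exact ⟨le_antisymm hbd (hlow b hb) ▸ hb, hlow⟩
  exact ⟨key hA hB, key hB hA⟩

theorem smul_quotient_mk (p f : MvPolynomial (Fin n) K) :
    p • Ideal.Quotient.mk I f = Ideal.Quotient.mk I (p * f) := rfl

namespace MinimalGradedFreeResolution

theorem betti_ne_zero_iff (𝓕 : MinimalGradedFreeResolution I) (i j : ℕ) :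
    𝓕.betti i j ≠ 0 ↔ ∃ a, 𝓕.degree i a = j := by
  rw [betti, Finset.card_ne_zero]
  simp [Finset.Nonempty]

theorem isHomogeneousMap_d (𝓕 : MinimalGradedFreeResolution I) (i : ℕ) :
    IsHomogeneousMap (𝓕.degree (i + 1)) (𝓕.degree i) (𝓕.d i) :=
  𝓕.d_homogeneous i

theorem constantCoeff_eq_zero_of_d_eq_zero (𝓕 : MinimalGradedFreeResolution I) (i : ℕ)
    (v : Fin (𝓕.rank (i + 1)) → MvPolynomial (Fin n) K) (hv : 𝓕.d i v = 0)
    (a : Fin (𝓕.rank (i + 1))) : constantCoeff (v a) = 0 := by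
  obtain ⟨w, rfl⟩ := (𝓕.exact_succ i v).1 hv
  exact (mem_idealOfVars_iff_constantCoeff _).1 (𝓕.minimal (i + 1) w a)

theorem constantCoeff_eq_zero_of_aug_eq_zero (𝓕 : MinimalGradedFreeResolution I)
    (v : Fin (𝓕.rank 0) → MvPolynomial (Fin n) K) (hv : 𝓕.aug v = 0)
    (a : Fin (𝓕.rank 0)) : constantCoeff (v a) = 0 := by
  obtain ⟨w, rfl⟩ := (𝓕.exact_zero v).1 hv
  exact (mem_idealOfVars_iff_constantCoeff _).1 (𝓕.minimal 0 w a)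

/-- The least degree of a generator of `Fᵢ₊₁` is the least degree of a nonzero homogeneous element
of the image of `Fᵢ₊₁` in `Fᵢ`. -/
theorem isLeast_betti_succ_iff (𝓕 : MinimalGradedFreeResolution I) (i d : ℕ) :
    IsLeast {j | 𝓕.betti (i + 1) j ≠ 0} d ↔
      IsLeast {j | ∃ v ≠ 0, IsHomogeneousVector (𝓕.degree i) v j ∧
        v ∈ LinearMap.range (𝓕.d i)} d := by
  classical
  refine isLeast_iff_of_mutually_coinitial ?_ ?_ d
  · rintro j hj
    obtain ⟨a, rfl⟩ := (𝓕.betti_ne_zero_iff _ _).1 hj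
    -- A basis vector is not in the kernel, since kernel elements have no constant terms.
    refine ⟨_, ⟨𝓕.d i (Pi.single a 1), fun h0 => ?_,
      𝓕.d_homogeneous i _ _ (isHomogeneousVector_single _ a), ⟨_, rfl⟩⟩, le_rfl⟩
    have := 𝓕.constantCoeff_eq_zero_of_d_eq_zero i _ h0 a
    simp at this
  · rintro j ⟨v, hv0, hvj, hv⟩
    obtain ⟨w, hwj, rfl⟩ := (𝓕.isHomogeneousMap_d i).exists_preimage hvj hv
    have hw0 : w ≠ 0 := by
      rintro rfl
      exact hv0 (map_zero _)
    -- A nonzero coordinate of a homogeneous preimage of degree `j` forces the corresponding basis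
    -- degree to be at most `j`.
    obtain ⟨a, ha⟩ := Function.ne_iff.1 hw0
    obtain ⟨m, hm⟩ := MvPolynomial.ne_zero_iff.1 ha
    have := hwj a m hm
    exact ⟨_, (𝓕.betti_ne_zero_iff _ _).2 ⟨a, rfl⟩, by omega⟩

/-- If `e_a` had positive degree, it would map to the class of some `f` without constant term. With
`v` mapping to 1, `e_a - f v` would be a kernel element whose `a`-th entry has constant term 1,
against minimality. -/
theorem degree_zero_eq_zero (𝓕 : MinimalGradedFreeResolution I) (a : Fin (𝓕.rank 0)) :
    𝓕.degree 0 a = 0 := by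
  classical
  by_contra hne
  obtain ⟨f, hf, haf⟩ := 𝓕.aug_homogeneous _ _ (isHomogeneousVector_single _ a)
  obtain ⟨v, hv⟩ := 𝓕.aug_surjective 1
  have hker : 𝓕.aug (Pi.single a 1 - f • v) = 0 := by
    rw [map_sub, map_smul, haf, hv, sub_eq_zero, ← map_one (Ideal.Quotient.mk I),
      smul_quotient_mk, mul_one]
  have := 𝓕.constantCoeff_eq_zero_of_aug_eq_zero _ hker a
  have hf0 : constantCoeff f = 0 := by
    rw [constantCoeff_eq]
    exact hf.coeff_eq_zero (by simpa using Ne.symm hne)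
  simp [hf0] at this

theorem exists_aug_single (𝓕 : MinimalGradedFreeResolution I) (a : Fin (𝓕.rank 0)) :
    ∃ c : K, c ≠ 0 ∧ 𝓕.aug (Pi.single a 1) = Ideal.Quotient.mk I (C c) := by
  classical
  obtain ⟨f, hf, haf⟩ := 𝓕.aug_homogeneous _ _ (isHomogeneousVector_single _ a)
  rw [𝓕.degree_zero_eq_zero a] at hf
  rw [← totalDegree_zero_iff_isHomogeneous, totalDegree_eq_zero_iff_eq_C] at hf
  refine ⟨coeff 0 f, fun h0 => ?_, by rw [← hf, haf]⟩
  rw [hf, h0, C_0, map_zero] at haf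
  have := 𝓕.constantCoeff_eq_zero_of_aug_eq_zero _ haf a
  simp at this

/-- Two basis vectors map to nonzero constants `c` and `c'`, so `c' e_a - c e_b` would be a kernel
element with nonzero constant terms. -/
theorem subsingleton_fin_rank_zero (𝓕 : MinimalGradedFreeResolution I) :
    Subsingleton (Fin (𝓕.rank 0)) := by
  classical
  refine ⟨fun a b => ?_⟩
  by_contra hab
  obtain ⟨c, hc, hac⟩ := 𝓕.exists_aug_single a
  obtain ⟨c', hc', hac'⟩ := 𝓕.exists_aug_single b
  have hker : 𝓕.aug ((C c' : MvPolynomial (Fin n) K) • Pi.single a 1 -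
      (C c : MvPolynomial (Fin n) K) • Pi.single b 1) = 0 := by
    rw [map_sub, map_smul, map_smul, hac, hac', sub_eq_zero, smul_quotient_mk,
      smul_quotient_mk, mul_comm]
  have := 𝓕.constantCoeff_eq_zero_of_aug_eq_zero _ hker a
  simp [Pi.single_eq_of_ne hab, hc'] at this

theorem nonempty_fin_rank_zero (𝓕 : MinimalGradedFreeResolution I) (hI : I ≠ ⊤) :
    Nonempty (Fin (𝓕.rank 0)) := by
  by_contra h
  rw [not_nonempty_iff] at h
  have := Ideal.Quotient.nontrivial_iff.2 hI
  obtain ⟨v, hv⟩ := 𝓕.aug_surjective 1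
  rw [Subsingleton.elim v 0, map_zero] at hv
  exact zero_ne_one hv

/-- The augmentation is the quotient map up to a nonzero scalar, so its kernel is `I` in the only
coordinate. -/
theorem mem_range_d_zero_iff (𝓕 : MinimalGradedFreeResolution I) (a : Fin (𝓕.rank 0))
    (v : Fin (𝓕.rank 0) → MvPolynomial (Fin n) K) :
    v ∈ LinearMap.range (𝓕.d 0) ↔ v a ∈ I := by
  classical
  have := 𝓕.subsingleton_fin_rank_zero
  obtain ⟨c, hc, hac⟩ := 𝓕.exists_aug_single a
  have hv : v = v a • Pi.single a 1 := by
    funext b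
    rw [Subsingleton.elim b a]
    simp
  have h := 𝓕.exact_zero v
  have haug : 𝓕.aug v = Ideal.Quotient.mk I (v a * C c) := by
    conv_lhs => rw [hv]
    rw [map_smul, hac, smul_quotient_mk]
  have hunit : IsUnit (C c : MvPolynomial (Fin n) K) := (isUnit_iff_ne_zero.2 hc).map C
  rw [LinearMap.mem_range, ← Set.mem_range, ← h, ← Ideal.mul_unit_mem_iff_mem I hunit,
    ← Ideal.Quotient.eq_zero_iff_mem, haug]

end MinimalGradedFreeResolution

end Resolutions

/-! ### Existence of minimal graded free resolutions -/

section Existence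

variable {K : Type*} [Field K] {n r : ℕ}

theorem exists_homogeneous_generators {deg : Fin r → ℕ}
    {Z : Submodule (MvPolynomial (Fin n) K) (Fin r → MvPolynomial (Fin n) K)}
    (hZ : ∀ v ∈ Z, ∀ j, vectorComponent K n deg j v ∈ Z) :
    ∃ (s : ℕ) (deg' : Fin s → ℕ) (z : Fin s → Fin r → MvPolynomial (Fin n) K),
      (∀ a, IsHomogeneousVector deg (z a) (deg' a)) ∧
        Submodule.span (MvPolynomial (Fin n) K) (Set.range z) = Z := by
  classical
  obtain ⟨S, hS⟩ := IsNoetherian.noetherian Z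
  choose N hN using fun v : Fin r → MvPolynomial (Fin n) K => exists_sum_vectorComponent_eq deg v
  let U : Finset (Σ _ : Fin r → MvPolynomial (Fin n) K, ℕ) := S.sigma fun v => Finset.range (N v)
  let e := U.equivFin.symm
  refine ⟨U.card, fun a => (e a).1.2, fun a => vectorComponent K n deg (e a).1.2 (e a).1.1,
    fun a => isHomogeneousVector_vectorComponent _ _ _, le_antisymm ?_ ?_⟩
  · rw [Submodule.span_le]
    rintro _ ⟨a, rfl⟩
    refine hZ _ ?_ _
    rw [← hS]
    exact Submodule.subset_span (Finset.mem_sigma.1 (e a).2).1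
  · rw [← hS, Submodule.span_le]
    intro v hv
    rw [SetLike.mem_coe, hN v]
    refine Submodule.sum_mem _ fun j hj => Submodule.subset_span ?_
    refine ⟨e.symm ⟨⟨v, j⟩, Finset.mem_sigma.2 ⟨hv, hj⟩⟩, ?_⟩
    simp only [Equiv.apply_symm_apply]

/-- A homogeneous generating family of least size works: a relation with a nonzero constant term in
some coefficient would make that generator redundant. -/
theorem exists_minimal_homogeneous_generators {deg : Fin r → ℕ}
    {Z : Submodule (MvPolynomial (Fin n) K) (Fin r → MvPolynomial (Fin n) K)}
    (hZ : ∀ v ∈ Z, ∀ j, vectorComponent K n deg j v ∈ Z) :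
    ∃ (s : ℕ) (deg' : Fin s → ℕ) (z : Fin s → Fin r → MvPolynomial (Fin n) K),
      (∀ a, IsHomogeneousVector deg (z a) (deg' a)) ∧
      Submodule.span (MvPolynomial (Fin n) K) (Set.range z) = Z ∧
      ∀ w, Fintype.linearCombination (MvPolynomial (Fin n) K) z w = 0 →
        ∀ a, constantCoeff (w a) = 0 := by
  classical
  have hex := exists_homogeneous_generators hZ
  obtain ⟨deg', z, hz, hspan⟩ := Nat.find_spec hex
  refine ⟨_, deg', z, hz, hspan, fun w hw a => ?_⟩
  by_contra hc
  have hmin := fun k => Nat.find_min (m := k) hex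
  generalize Nat.find hex = s at *
  obtain _ | k := s
  · exact a.elim0
  refine hmin k k.lt_succ_self
    ⟨deg' ∘ a.succAbove, z ∘ a.succAbove, fun b => hz _, le_antisymm ?_ ?_⟩
  · rw [← hspan]
    exact Submodule.span_mono (Set.range_comp_subset_range _ _)
  · rw [← hspan, Submodule.span_le]
    rintro _ ⟨b, rfl⟩
    obtain rfl | ⟨b, rfl⟩ := a.eq_self_or_eq_succAbove b
    -- In the component of degree `deg' b` of the relation, the coefficient of `z b` has degree 0,
    -- hence is a unit, and `z b` can be solved for.
    · set u := vectorComponent K n deg' (deg' b) w with hu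
      have hker : Fintype.linearCombination (MvPolynomial (Fin n) K) z u = 0 := by
        rw [hu, ← (isHomogeneousMap_linearCombination hz).vectorComponent_map, hw, map_zero]
      have hub : u b = C (constantCoeff (w b)) := by
        ext m
        rw [hu, coeff_vectorComponent, coeff_C, constantCoeff_eq]
        by_cases hm : m = 0
        · subst hm
          simp
        · have : m.degree ≠ 0 := by simpa [Finsupp.degree_eq_zero_iff] using hm
          rw [if_neg (by omega), if_neg (Ne.symm hm)]
      rw [Fintype.linearCombination_apply, Fin.sum_univ_succAbove _ b, hub] at hker
      have hunit : IsUnit (C (constantCoeff (w b)) : MvPolynomial (Fin n) K) :=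
        (isUnit_iff_ne_zero.2 hc).map C
      rw [SetLike.mem_coe, ← Submodule.smul_mem_iff_of_isUnit _ hunit,
        eq_neg_of_add_eq_zero_left hker]
      exact Submodule.neg_mem _ (Submodule.sum_mem _ fun i _ =>
        Submodule.smul_mem _ _ (Submodule.subset_span ⟨i, rfl⟩))
    · exact Submodule.subset_span ⟨b, rfl⟩

/-- A graded free module of finite rank with a graded submodule contained in its multiple by the
irrelevant ideal. -/
structure GradedSubmodule (K : Type*) [Field K] (n : ℕ) where
  /-- the rank of the free module -/
  rank : ℕ
  /-- the degrees of its basis elements -/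
  degree : Fin rank → ℕ
  /-- the submodule -/
  carrier : Submodule (MvPolynomial (Fin n) K) (Fin rank → MvPolynomial (Fin n) K)
  component_mem : ∀ v ∈ carrier, ∀ j, vectorComponent K n degree j v ∈ carrier
  constantCoeff_eq_zero : ∀ v ∈ carrier, ∀ a, constantCoeff (v a) = 0

/-- Minimality of the generators says that the kernel again lies in the irrelevant multiple, so the
construction can be iterated. -/
theorem GradedSubmodule.exists_cover (Z : GradedSubmodule K n) :
    ∃ (Z' : GradedSubmodule K n)
      (L : (Fin Z'.rank → MvPolynomial (Fin n) K) →ₗ[MvPolynomial (Fin n) K]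
        (Fin Z.rank → MvPolynomial (Fin n) K)),
      IsHomogeneousMap Z'.degree Z.degree L ∧ LinearMap.range L = Z.carrier ∧
        LinearMap.ker L = Z'.carrier := by
  obtain ⟨s, deg', z, hz, hspan, hmin⟩ := exists_minimal_homogeneous_generators Z.component_mem
  have hL := isHomogeneousMap_linearCombination hz
  refine ⟨⟨s, deg', LinearMap.ker (Fintype.linearCombination _ z), fun v hv j => ?_,
    fun v hv => hmin v hv⟩, Fintype.linearCombination _ z, hL, ?_, rfl⟩
  · rw [LinearMap.mem_ker] at hv ⊢
    rw [← hL.vectorComponent_map, hv, map_zero]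
  · rw [Fintype.range_linearCombination, hspan]

/-- A minimal homogeneous cover of a graded submodule, with its kernel. -/
noncomputable def GradedSubmodule.next (Z : GradedSubmodule K n) : GradedSubmodule K n :=
  Z.exists_cover.choose

/-- The covering map. -/
noncomputable def GradedSubmodule.cover (Z : GradedSubmodule K n) :
    (Fin Z.next.rank → MvPolynomial (Fin n) K) →ₗ[MvPolynomial (Fin n) K]
      (Fin Z.rank → MvPolynomial (Fin n) K) :=
  Z.exists_cover.choose_spec.choose

theorem GradedSubmodule.cover_spec (Z : GradedSubmodule K n) :
    IsHomogeneousMap Z.next.degree Z.degree Z.cover ∧ LinearMap.range Z.cover = Z.carrier ∧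
      LinearMap.ker Z.cover = Z.next.carrier :=
  Z.exists_cover.choose_spec.choose_spec

theorem GradedSubmodule.cover_eq_zero_iff (Z : GradedSubmodule K n)
    (v : Fin Z.next.rank → MvPolynomial (Fin n) K) : Z.cover v = 0 ↔ v ∈ Z.next.carrier := by
  rw [← Z.cover_spec.2.2, LinearMap.mem_ker]

theorem GradedSubmodule.mem_range_cover_iff (Z : GradedSubmodule K n)
    (v : Fin Z.rank → MvPolynomial (Fin n) K) : v ∈ Set.range Z.cover ↔ v ∈ Z.carrier := by
  rw [← Z.cover_spec.2.1, LinearMap.mem_range, Set.mem_range]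

/-- A proper homogeneous ideal as a graded submodule of the free module of rank one. -/
noncomputable def GradedSubmodule.ofIdeal (I : Ideal (MvPolynomial (Fin n) K))
    (hI : ∀ p ∈ I, ∀ j, homogeneousComponent j p ∈ I) (h0 : ∀ p ∈ I, constantCoeff p = 0) :
    GradedSubmodule K n where
  rank := 1
  degree _ := 0
  carrier := Submodule.comap (LinearMap.proj 0) I
  component_mem v hv j := by
    have := hI _ hv j
    simpa [vectorComponent] using this
  constantCoeff_eq_zero v hv a := by
    rw [Subsingleton.elim a 0]
    exact h0 _ hv

/-- The sequence of syzygy modules of a graded submodule. -/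
noncomputable def GradedSubmodule.syzygies (Z : GradedSubmodule K n) : ℕ → GradedSubmodule K n
  | 0 => Z
  | i + 1 => (Z.syzygies i).next

/-- The minimal graded free resolution of the quotient by a proper homogeneous ideal. -/
noncomputable def minimalGradedFreeResolutionOfIdeal (I : Ideal (MvPolynomial (Fin n) K))
    (hI : ∀ p ∈ I, ∀ j, homogeneousComponent j p ∈ I) (h0 : ∀ p ∈ I, constantCoeff p = 0) :
    MinimalGradedFreeResolution I where
  rank i := ((GradedSubmodule.ofIdeal I hI h0).syzygies i).rank
  degree i := ((GradedSubmodule.ofIdeal I hI h0).syzygies i).degree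
  aug := Submodule.mkQ I ∘ₗ
    (LinearMap.proj 0 : (Fin 1 → MvPolynomial (Fin n) K) →ₗ[MvPolynomial (Fin n) K] _)
  d i := ((GradedSubmodule.ofIdeal I hI h0).syzygies i).cover
  aug_homogeneous v j hv := by
    refine ⟨v (0 : Fin 1), ?_, rfl⟩
    intro m hm
    have h := hv (0 : Fin 1) m hm
    change m.degree + 0 = j at h
    rw [← h, add_zero, Finsupp.degree_eq_weight_one]
    rfl
  d_homogeneous i := ((GradedSubmodule.ofIdeal I hI h0).syzygies i).cover_spec.1
  aug_surjective p := by
    obtain ⟨p, rfl⟩ := Submodule.mkQ_surjective I p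
    exact ⟨fun _ => p, rfl⟩
  exact_zero v := (Submodule.Quotient.mk_eq_zero I).trans
    (((GradedSubmodule.ofIdeal I hI h0).syzygies 0).mem_range_cover_iff v).symm
  exact_succ i v := (((GradedSubmodule.ofIdeal I hI h0).syzygies i).cover_eq_zero_iff v).trans
    (((GradedSubmodule.ofIdeal I hI h0).syzygies (i + 1)).mem_range_cover_iff v).symm
  minimal i v a := by
    rw [mem_idealOfVars_iff_constantCoeff]
    refine ((GradedSubmodule.ofIdeal I hI h0).syzygies i).constantCoeff_eq_zero _ ?_ a
    exact (((GradedSubmodule.ofIdeal I hI h0).syzygies i).mem_range_cover_iff _).1 ⟨v, rfl⟩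

end Existence

/-! ### Initial degrees for squarefree monomial ideals -/

section SquarefreeMonomialIdeals

variable {K : Type*} [Field K] {n : ℕ}

/-- The exponent vector of the squarefree monomial `∏ i ∈ σ, xᵢ`. -/
noncomputable def squarefreeExponent (σ : Finset (Fin n)) : Fin n →₀ ℕ :=
  ∑ i ∈ σ, Finsupp.single i 1

theorem squarefreeExponent_apply (σ : Finset (Fin n)) (i : Fin n) :
    squarefreeExponent σ i = if i ∈ σ then 1 else 0 := by
  rw [squarefreeExponent, Finsupp.finsetSum_apply]
  simp [Finsupp.single_apply]

theorem degree_squarefreeExponent (σ : Finset (Fin n)) :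
    (squarefreeExponent σ).degree = σ.card := by
  rw [squarefreeExponent, map_sum]
  simp

theorem squarefreeExponent_le_iff (σ : Finset (Fin n)) (m : Fin n →₀ ℕ) :
    squarefreeExponent σ ≤ m ↔ ∀ i ∈ σ, m i ≠ 0 := by
  rw [Finsupp.le_def]
  refine forall_congr' fun i => ?_
  rw [squarefreeExponent_apply]
  split_ifs with h <;> simp [h, Nat.one_le_iff_ne_zero]

theorem squarefreeExponent_le_squarefreeExponent_iff (σ τ : Finset (Fin n)) :
    squarefreeExponent σ ≤ squarefreeExponent τ ↔ σ ⊆ τ := by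
  rw [squarefreeExponent_le_iff]
  simp [squarefreeExponent_apply, Finset.subset_iff]

theorem squarefreeExponent_sdiff_add (σ τ : Finset (Fin n)) :
    squarefreeExponent (σ \ τ) + squarefreeExponent τ = squarefreeExponent (σ ∪ τ) := by
  ext i
  simp only [Finsupp.add_apply, squarefreeExponent_apply, Finset.mem_sdiff, Finset.mem_union]
  by_cases h : i ∈ σ <;> by_cases h' : i ∈ τ <;> simp [h, h']

theorem prod_X_eq_monomial (σ : Finset (Fin n)) :
    ∏ i ∈ σ, (X i : MvPolynomial (Fin n) K) = monomial (squarefreeExponent σ) 1 := by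
  rw [squarefreeExponent, monomial_sum_one]
  rfl

variable (K) in
/-- The squarefree monomial ideal generated by the monomials `∏ i ∈ σ, xᵢ` for `σ ∈ S`. -/
noncomputable def squarefreeIdeal (S : Set (Finset (Fin n))) : Ideal (MvPolynomial (Fin n) K) :=
  Ideal.span {f | ∃ σ ∈ S, f = ∏ i ∈ σ, X i}

theorem mem_squarefreeIdeal_iff {S : Set (Finset (Fin n))} {p : MvPolynomial (Fin n) K} :
    p ∈ squarefreeIdeal K S ↔ ∀ m, p.coeff m ≠ 0 → ∃ σ ∈ S, squarefreeExponent σ ≤ m := by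
  have : {f : MvPolynomial (Fin n) K | ∃ σ ∈ S, f = ∏ i ∈ σ, X i} =
      (fun s => monomial s (1 : K)) '' (squarefreeExponent '' S) := by
    ext f
    simp [prod_X_eq_monomial, eq_comm]
  rw [squarefreeIdeal, this, mem_ideal_span_monomial_image]
  simp

theorem monomial_mem_squarefreeIdeal {S : Set (Finset (Fin n))} {σ : Finset (Fin n)}
    (hσ : σ ∈ S) : monomial (squarefreeExponent σ) (1 : K) ∈ squarefreeIdeal K S :=
  Ideal.subset_span ⟨σ, hσ, (prod_X_eq_monomial σ).symm⟩

theorem homogeneousComponent_mem_squarefreeIdeal {S : Set (Finset (Fin n))}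
    {p : MvPolynomial (Fin n) K} (hp : p ∈ squarefreeIdeal K S) (j : ℕ) :
    homogeneousComponent j p ∈ squarefreeIdeal K S := by
  rw [mem_squarefreeIdeal_iff] at hp ⊢
  intro m hm
  refine hp m fun h => hm ?_
  simp [coeff_homogeneousComponent, h]

theorem constantCoeff_eq_zero_of_mem_squarefreeIdeal {S : Set (Finset (Fin n))}
    (hne : ∀ σ ∈ S, σ.Nonempty) {p : MvPolynomial (Fin n) K} (hp : p ∈ squarefreeIdeal K S) :
    constantCoeff p = 0 := by
  by_contra h
  obtain ⟨σ, hσ, hle⟩ := mem_squarefreeIdeal_iff.1 hp 0 h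
  obtain ⟨i, hi⟩ := hne σ hσ
  exact (squarefreeExponent_le_iff _ _).1 hle i hi rfl

theorem squarefreeIdeal_ne_top {S : Set (Finset (Fin n))} (hne : ∀ σ ∈ S, σ.Nonempty) :
    squarefreeIdeal K S ≠ ⊤ := by
  intro h
  have := constantCoeff_eq_zero_of_mem_squarefreeIdeal (K := K) hne (p := 1) (h ▸ trivial)
  simp at this

theorem isLeast_betti_one_squarefreeIdeal_iff {S : Set (Finset (Fin n))}
    (hne : ∀ σ ∈ S, σ.Nonempty) (𝓕 : MinimalGradedFreeResolution (squarefreeIdeal K S)) (d : ℕ) :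
    IsLeast {j | 𝓕.betti 1 j ≠ 0} d ↔ IsLeast {j | ∃ σ ∈ S, σ.card = j} d := by
  obtain ⟨z⟩ := 𝓕.nonempty_fin_rank_zero (squarefreeIdeal_ne_top hne)
  have := 𝓕.subsingleton_fin_rank_zero
  rw [𝓕.isLeast_betti_succ_iff 0]
  refine isLeast_iff_of_mutually_coinitial ?_ ?_ d
  · rintro j ⟨v, hv0, hvj, hv⟩
    obtain ⟨a, ha⟩ := Function.ne_iff.1 hv0
    obtain ⟨m, hm⟩ := MvPolynomial.ne_zero_iff.1 ha
    obtain ⟨σ, hσ, hle⟩ :=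
      mem_squarefreeIdeal_iff.1 ((𝓕.mem_range_d_zero_iff a v).1 hv) m hm
    have h := hvj a m hm
    rw [𝓕.degree_zero_eq_zero, add_zero] at h
    refine ⟨_, ⟨σ, hσ, rfl⟩, ?_⟩
    rw [← h, ← degree_squarefreeExponent]
    exact Finsupp.degree_mono hle
  · rintro _ ⟨σ, hσ, rfl⟩
    refine ⟨_, ⟨fun _ => monomial (squarefreeExponent σ) 1, fun h => ?_, ?_, ?_⟩, le_rfl⟩
    · have := congrFun h z
      simp at this
    · intro a m hm
      rw [𝓕.degree_zero_eq_zero, add_zero, ← degree_squarefreeExponent]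
      rw [coeff_monomial] at hm
      by_contra h
      exact hm (if_neg fun h' => h (by rw [h']))
    · rw [𝓕.mem_range_d_zero_iff z]
      exact monomial_mem_squarefreeIdeal hσ

/-- The map sending the `k`-th basis vector to the vector all of whose `t` entries are the
monomial `∏ i ∈ σ k, xᵢ`; for `t = 1` it presents the ideal generated by these monomials. -/
noncomputable def monomialPresentation (K : Type*) [Field K] {s : ℕ} (t : ℕ)
    (σ : Fin s → Finset (Fin n)) :
    (Fin s → MvPolynomial (Fin n) K) →ₗ[MvPolynomial (Fin n) K]
      (Fin t → MvPolynomial (Fin n) K) :=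
  Fintype.linearCombination _ fun k _ => monomial (squarefreeExponent (σ k)) 1

theorem monomialPresentation_apply {s t : ℕ} (σ : Fin s → Finset (Fin n))
    (f : Fin s → MvPolynomial (Fin n) K) (a : Fin t) :
    monomialPresentation K t σ f a = ∑ k, f k * monomial (squarefreeExponent (σ k)) 1 := by
  simp [monomialPresentation, Fintype.linearCombination_apply]

theorem isHomogeneousMap_monomialPresentation {s t : ℕ} (σ : Fin s → Finset (Fin n))
    {deg : Fin t → ℕ} (hdeg : ∀ a, deg a = 0) :
    IsHomogeneousMap (fun k => (σ k).card) deg (monomialPresentation K t σ) := by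
  refine isHomogeneousMap_linearCombination fun k a m hm => ?_
  rw [hdeg, add_zero, ← degree_squarefreeExponent]
  rw [coeff_monomial] at hm
  by_contra h
  exact hm (if_neg fun h' => h (by rw [h']))

theorem mem_range_monomialPresentation_iff {s t : ℕ} [Subsingleton (Fin t)]
    (σ : Fin s → Finset (Fin n)) (a : Fin t) (v : Fin t → MvPolynomial (Fin n) K) :
    v ∈ LinearMap.range (monomialPresentation K t σ) ↔ v a ∈ squarefreeIdeal K (Set.range σ) := by
  have : {f : MvPolynomial (Fin n) K | ∃ τ ∈ Set.range σ, f = ∏ i ∈ τ, X i} =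
      Set.range fun k => monomial (squarefreeExponent (σ k)) (1 : K) := by
    ext f
    simp [prod_X_eq_monomial, eq_comm]
  rw [squarefreeIdeal, this, Ideal.mem_span_range_iff_exists_fun, LinearMap.mem_range]
  refine exists_congr fun f => ⟨fun h => ?_, fun h => ?_⟩
  · rw [← h, monomialPresentation_apply]
  · funext b
    rw [Subsingleton.elim b a, monomialPresentation_apply, h]

/-- In an antichain no other generator divides x^{σ k}, so the coefficient of that monomial in the
relation is just the constant term of `f k`. -/
theorem constantCoeff_eq_zero_of_monomialPresentation_eq_zero {s t : ℕ}
    {σ : Fin s → Finset (Fin n)} (hσ : ∀ k l, σ k ⊆ σ l → k = l) (a : Fin t)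
    (f : Fin s → MvPolynomial (Fin n) K) (hf : monomialPresentation K t σ f = 0) (k : Fin s) :
    constantCoeff (f k) = 0 := by
  have h := congrArg (coeff (squarefreeExponent (σ k))) (congrFun hf a)
  rw [monomialPresentation_apply, coeff_sum, Pi.zero_apply, coeff_zero,
    Finset.sum_eq_single k] at h
  · rwa [coeff_mul_monomial', if_pos le_rfl, tsub_self, mul_one, ← constantCoeff_eq] at h
  · intro l _ hlk
    rw [coeff_mul_monomial', if_neg]
    rw [squarefreeExponent_le_squarefreeExponent_iff]
    exact fun h => hlk (hσ _ _ h)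
  · simp

theorem exists_card_union_le_of_monomialPresentation_eq_zero {s t : ℕ}
    {σ : Fin s → Finset (Fin n)} (a : Fin t) {f : Fin s → MvPolynomial (Fin n) K} {j : ℕ}
    (hf0 : f ≠ 0) (hfj : IsHomogeneousVector (fun k => (σ k).card) f j)
    (hf : monomialPresentation K t σ f = 0) : ∃ k l, k ≠ l ∧ (σ k ∪ σ l).card ≤ j := by
  obtain ⟨k, hk⟩ := Function.ne_iff.1 hf0
  obtain ⟨m, hm⟩ := MvPolynomial.ne_zero_iff.1 hk
  have h := congrArg (coeff (m + squarefreeExponent (σ k))) (congrFun hf a)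
  rw [monomialPresentation_apply, coeff_sum, Pi.zero_apply, coeff_zero,
    ← Finset.add_sum_erase _ _ (Finset.mem_univ k), coeff_mul_monomial, mul_one] at h
  -- The term at `m + σ k` must cancel against another generator's, so this monomial is divisible by
  -- both and hence by their lcm.
  have hsum : ∑ l ∈ Finset.univ.erase k, coeff (m + squarefreeExponent (σ k))
      (f l * monomial (squarefreeExponent (σ l)) 1) ≠ 0 := fun h0 => hm (by rwa [h0, add_zero] at h)
  obtain ⟨l, hl, hne⟩ := Finset.exists_ne_zero_of_sum_ne_zero hsum
  refine ⟨k, l, (Finset.ne_of_mem_erase hl).symm, ?_⟩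
  have hle : squarefreeExponent (σ l) ≤ m + squarefreeExponent (σ k) := by
    by_contra hle
    rw [coeff_mul_monomial', if_neg hle] at hne
    exact hne rfl
  have hunion : squarefreeExponent (σ k ∪ σ l) ≤ m + squarefreeExponent (σ k) := by
    rw [squarefreeExponent_le_iff]
    intro i hi
    rcases Finset.mem_union.1 hi with hi | hi
    · exact (squarefreeExponent_le_iff _ _).1 le_add_self i hi
    · exact (squarefreeExponent_le_iff _ _).1 hle i hi
  have hdeg := Finsupp.degree_mono hunion
  rw [map_add, degree_squarefreeExponent, degree_squarefreeExponent] at hdeg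
  exact hdeg.trans (hfj k m hm).le

/-- The witness is the pair syzygy x^{σ l \ σ k} e_k - x^{σ k \ σ l} e_l, both of whose terms map to
the lcm. -/
theorem exists_monomialPresentation_eq_zero {s : ℕ} (t : ℕ) (σ : Fin s → Finset (Fin n))
    {k l : Fin s} (hkl : k ≠ l) :
    ∃ f ≠ 0, IsHomogeneousVector (fun k => (σ k).card) f (σ k ∪ σ l).card ∧
      monomialPresentation K t σ f = 0 := by
  classical
  refine ⟨monomial (squarefreeExponent (σ l \ σ k)) (1 : K) • Pi.single k 1 +
    monomial (squarefreeExponent (σ k \ σ l)) (-1 : K) • Pi.single l 1, fun h => ?_, ?_, ?_⟩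
  · have := congrFun h k
    simp [Pi.single_eq_of_ne hkl] at this
  · refine IsHomogeneousVector.add ?_ ?_
    · rw [Finset.union_comm, ← Finset.card_sdiff_add_card]
      exact (isHomogeneousVector_single _ k).smul_of_isHomogeneous
        (isHomogeneous_monomial _ (degree_squarefreeExponent _))
    · rw [← Finset.card_sdiff_add_card]
      exact (isHomogeneousVector_single _ l).smul_of_isHomogeneous
        (isHomogeneous_monomial _ (degree_squarefreeExponent _))
  · rw [map_add, map_smul, map_smul, monomialPresentation, Fintype.linearCombination_apply_single,
      Fintype.linearCombination_apply_single, one_smul, one_smul]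
    funext a
    simp only [Pi.add_apply, Pi.smul_apply, smul_eq_mul, monomial_mul,
      squarefreeExponent_sdiff_add, Finset.union_comm (σ l) (σ k), Pi.zero_apply, ← map_add]
    simp

theorem isLeast_betti_two_squarefreeIdeal_iff {S : Set (Finset (Fin n))}
    (hne : ∀ σ ∈ S, σ.Nonempty) (hanti : ∀ σ ∈ S, ∀ τ ∈ S, σ ⊆ τ → σ = τ)
    (𝓕 : MinimalGradedFreeResolution (squarefreeIdeal K S)) (d : ℕ) :
    IsLeast {j | 𝓕.betti 2 j ≠ 0} d ↔
      IsLeast {j | ∃ σ ∈ S, ∃ τ ∈ S, σ ≠ τ ∧ (σ ∪ τ).card = j} d := by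
  classical
  obtain ⟨s, σ, hinj, rfl⟩ : ∃ (s : ℕ) (σ : Fin s → Finset (Fin n)),
      Function.Injective σ ∧ Set.range σ = S := by
    refine ⟨_, fun k => (S.toFinite.toFinset.equivFin.symm k : Finset (Fin n)),
      Subtype.val_injective.comp (Equiv.injective _), ?_⟩
    ext τ
    constructor
    · rintro ⟨k, rfl⟩
      exact S.toFinite.mem_toFinset.1 (S.toFinite.toFinset.equivFin.symm k).2
    · intro hτ
      exact ⟨S.toFinite.toFinset.equivFin ⟨τ, S.toFinite.mem_toFinset.2 hτ⟩, by simp⟩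
  obtain ⟨z⟩ := 𝓕.nonempty_fin_rank_zero (squarefreeIdeal_ne_top hne)
  have := 𝓕.subsingleton_fin_rank_zero
  have hd := 𝓕.isHomogeneousMap_d 0
  have hT := isHomogeneousMap_monomialPresentation (K := K) σ 𝓕.degree_zero_eq_zero
  -- Giving the monomial presentation `𝓕.rank 0` target coordinates puts both maps into the same
  -- module, with no cast along `𝓕.rank 0 = 1`.
  have hrange : LinearMap.range (𝓕.d 0) =
      LinearMap.range (monomialPresentation K (𝓕.rank 0) σ) := by
    ext v
    rw [𝓕.mem_range_d_zero_iff z, mem_range_monomialPresentation_iff σ z]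
  have hminT := constantCoeff_eq_zero_of_monomialPresentation_eq_zero (K := K) (σ := σ)
    (fun k l h => hinj (hanti _ ⟨k, rfl⟩ _ ⟨l, rfl⟩ h)) z
  rw [𝓕.isLeast_betti_succ_iff 1]
  refine isLeast_iff_of_mutually_coinitial ?_ ?_ d
  · rintro j ⟨v, hv0, hvj, hv⟩
    obtain ⟨f, hf0, hfj, hf⟩ := hd.exists_mem_ker_of_range_eq hT hrange
      (𝓕.constantCoeff_eq_zero_of_d_eq_zero 0) ⟨v, hv0, hvj, (𝓕.exact_succ 0 v).2 hv⟩
    obtain ⟨k, l, hkl, hle⟩ := exists_card_union_le_of_monomialPresentation_eq_zero z hf0 hfj hf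
    exact ⟨_, ⟨_, ⟨k, rfl⟩, _, ⟨l, rfl⟩, hinj.ne hkl, rfl⟩, hle⟩
  · rintro _ ⟨_, ⟨k, rfl⟩, _, ⟨l, rfl⟩, hkl, rfl⟩
    obtain ⟨v, hv0, hvj, hv⟩ := hT.exists_mem_ker_of_range_eq hd hrange.symm hminT
      (exists_monomialPresentation_eq_zero _ σ (ne_of_apply_ne σ hkl))
    exact ⟨_, ⟨v, hv0, hvj, (𝓕.exact_succ 0 v).1 hv⟩, le_rfl⟩

end SquarefreeMonomialIdeals

/-! ### Supports and weights of words of minimal support -/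

section Codes

variable {F : Type*} [Field F] {n : ℕ}

theorem mem_wordSupport {c : Fin n → F} {i : Fin n} : i ∈ wordSupport c ↔ c i ≠ 0 := by
  simp [wordSupport]

theorem wordSupport_nonempty {c : Fin n → F} (hc : c ≠ 0) : (wordSupport c).Nonempty := by
  obtain ⟨i, hi⟩ := Function.ne_iff.1 hc
  exact ⟨i, mem_wordSupport.2 hi⟩

theorem wordSupport_smul {a : F} (ha : a ≠ 0) (c : Fin n → F) :
    wordSupport (a • c) = wordSupport c := by
  ext i
  simp [mem_wordSupport, ha]

theorem mem_spaceSupport_span {s : Set (Fin n → F)} {i : Fin n} :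
    i ∈ spaceSupport (Submodule.span F s) ↔ ∃ c ∈ s, i ∈ wordSupport c := by
  constructor
  · rintro ⟨c, hc, hi⟩
    by_contra! h
    have hle : Submodule.span F s ≤ LinearMap.ker (LinearMap.proj i) := by
      rw [Submodule.span_le]
      intro c' hc'
      simpa [mem_wordSupport] using h c' hc'
    exact mem_wordSupport.1 hi (hle hc)
  · rintro ⟨c, hc, hi⟩
    exact ⟨c, Submodule.subset_span hc, hi⟩

theorem spaceWeight_span_singleton (c : Fin n → F) :
    spaceWeight (Submodule.span F {c}) = wordWeight c := by
  have : spaceSupport (Submodule.span F {c}) = (wordSupport c : Set (Fin n)) := by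
    ext i
    simp [mem_spaceSupport_span]
  rw [spaceWeight, this, Set.ncard_coe_finset, wordWeight]

theorem spaceWeight_span_pair (c₁ c₂ : Fin n → F) :
    spaceWeight (Submodule.span F {c₁, c₂}) = (wordSupport c₁ ∪ wordSupport c₂).card := by
  have : spaceSupport (Submodule.span F {c₁, c₂}) =
      ((wordSupport c₁ ∪ wordSupport c₂ : Finset (Fin n)) : Set (Fin n)) := by
    ext i
    simp [mem_spaceSupport_span]
  rw [spaceWeight, this, Set.ncard_coe_finset]

theorem generalizedHammingWeight_one (C : Submodule F (Fin n → F)) :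
    generalizedHammingWeight C 1 = minimumWeight C := by
  rw [generalizedHammingWeight, minimumWeight]
  congr 1
  ext w
  constructor
  · rintro ⟨D, hD, hrank, rfl⟩
    have hne : D ≠ ⊥ := by
      rintro rfl
      simp at hrank
    obtain ⟨c, hc, hc0⟩ := Submodule.exists_mem_ne_zero_of_ne_bot hne
    have hspan : Submodule.span F {c} = D := by
      refine Submodule.eq_of_le_of_finrank_eq ?_ ?_
      · rwa [Submodule.span_singleton_le_iff_mem]
      · rw [finrank_span_singleton hc0, hrank]
    exact ⟨c, hD hc, hc0, by rw [← hspan, spaceWeight_span_singleton]⟩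
  · rintro ⟨c, hc, hc0, rfl⟩
    exact ⟨_, by rwa [Submodule.span_singleton_le_iff_mem], finrank_span_singleton hc0,
      spaceWeight_span_singleton c⟩

theorem finrank_span_pair_eq_two_iff (c₁ c₂ : Fin n → F) :
    Module.finrank F (Submodule.span F {c₁, c₂}) = 2 ↔
      ∀ a b : F, a • c₁ + b • c₂ = 0 → a = 0 ∧ b = 0 := by
  rw [← LinearIndependent.pair_iff, linearIndependent_iff_card_eq_finrank_span,
    Matrix.range_cons_cons_empty, Set.finrank, Fintype.card_fin, eq_comm]

theorem wordSupport_eq_of_subset_of_mem_minimalSupportCodewords {C : Submodule F (Fin n → F)}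
    {c₁ c₂ : Fin n → F} (h₁ : c₁ ∈ minimalSupportCodewords C)
    (h₂ : c₂ ∈ minimalSupportCodewords C) (h : wordSupport c₁ ⊆ wordSupport c₂) :
    wordSupport c₁ = wordSupport c₂ := by
  by_contra hne
  exact h₂.2.2 c₁ h₁.1 h₁.2.1 (Finset.ssubset_iff_subset_ne.2 ⟨h, hne⟩)

/-- Two words of minimal support are linearly independent if and only if their supports differ. -/
theorem finrank_span_pair_eq_two_iff_wordSupport_ne {C : Submodule F (Fin n → F)}
    {c₁ c₂ : Fin n → F} (h₁ : c₁ ∈ minimalSupportCodewords C)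
    (h₂ : c₂ ∈ minimalSupportCodewords C) :
    Module.finrank F (Submodule.span F {c₁, c₂}) = 2 ↔ wordSupport c₁ ≠ wordSupport c₂ := by
  rw [finrank_span_pair_eq_two_iff]
  constructor
  · intro h heq
    obtain ⟨i, hi⟩ := wordSupport_nonempty h₁.2.1
    have hi₂ := hi
    rw [heq, mem_wordSupport] at hi₂
    -- This combination cancels coordinate `i` of the common support: if zero, it is a dependence;
    -- if not, its support is properly inside that of `c₁`, against minimality.
    by_cases h0 : c₂ i • c₁ + (-c₁ i) • c₂ = 0
    · exact hi₂ (h _ _ h0).1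
    · refine h₁.2.2 _ (C.add_mem (C.smul_mem _ h₁.1) (C.smul_mem _ h₂.1)) h0 ?_
      rw [Finset.ssubset_iff_of_subset]
      · refine ⟨i, hi, ?_⟩
        simp [mem_wordSupport, mul_comm]
      · intro k hk
        rw [mem_wordSupport] at hk
        by_contra hk₁
        have hk₂ := hk₁
        rw [heq] at hk₂
        rw [mem_wordSupport, not_not] at hk₁ hk₂
        simp [hk₁, hk₂] at hk
  · intro hne a b hab
    by_cases ha : a = 0
    · subst ha
      rw [zero_smul, zero_add, smul_eq_zero] at hab
      exact ⟨rfl, hab.resolve_right h₂.2.1⟩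
    · exfalso
      by_cases hb : b = 0
      · rw [hb, zero_smul, add_zero, smul_eq_zero] at hab
        exact hab.elim ha h₁.2.1
      · apply hne
        rw [← wordSupport_smul ha, eq_neg_of_add_eq_zero_left hab, ← neg_smul,
          wordSupport_smul (neg_ne_zero.2 hb)]

theorem isD2TestSet_iff {C : Submodule F (Fin n → F)} {M : Set (Fin n → F)}
    (hM : M ⊆ minimalSupportCodewords C) :
    IsD2TestSet C M ↔ ∃ σ ∈ supportSet M, ∃ τ ∈ supportSet M, σ ≠ τ ∧
      (σ ∪ τ).card = generalizedHammingWeight C 2 := by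
  constructor
  · rintro ⟨-, c₁, h₁, c₂, h₂, hrank, hw⟩
    refine ⟨_, ⟨c₁, h₁, rfl⟩, _, ⟨c₂, h₂, rfl⟩,
      (finrank_span_pair_eq_two_iff_wordSupport_ne (hM h₁) (hM h₂)).1 hrank, ?_⟩
    rw [← hw, spaceWeight_span_pair]
  · rintro ⟨_, ⟨c₁, h₁, rfl⟩, _, ⟨c₂, h₂, rfl⟩, hne, hw⟩
    exact ⟨hM, c₁, h₁, c₂, h₂,
      (finrank_span_pair_eq_two_iff_wordSupport_ne (hM h₁) (hM h₂)).2 hne, by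
        rw [spaceWeight_span_pair, hw]⟩

/-- The two words span a plane inside `C`, which competes in the minimum defining d₂. -/
theorem generalizedHammingWeight_two_le {C : Submodule F (Fin n → F)} {M : Set (Fin n → F)}
    (hM : M ⊆ minimalSupportCodewords C) {σ τ : Finset (Fin n)} (hσ : σ ∈ supportSet M)
    (hτ : τ ∈ supportSet M) (hne : σ ≠ τ) :
    generalizedHammingWeight C 2 ≤ (σ ∪ τ).card := by
  obtain ⟨c₁, h₁, rfl⟩ := hσ
  obtain ⟨c₂, h₂, rfl⟩ := hτ
  refine Nat.sInf_le ⟨Submodule.span F {c₁, c₂}, ?_,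
    (finrank_span_pair_eq_two_iff_wordSupport_ne (hM h₁) (hM h₂)).2 hne,
    spaceWeight_span_pair _ _⟩
  rw [Submodule.span_le]
  rintro c (rfl | rfl)
  · exact (hM h₁).1
  · exact (hM h₂).1

end Codes

/-! ### The main theorem -/

theorem theorem6p2 {F : Type*} [Field F] [Finite F] {n : ℕ} (C : Submodule F (Fin n → F))
    (K : Type*) [Field K] (M : Set (Fin n → F)) (hM : M ⊆ minimalSupportCodewords C)
    (hS : 2 ≤ (supportSet M).ncard) :
    Nonempty (MinimalGradedFreeResolution (supportIdeal K M)) ∧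
    ∀ 𝓕 : MinimalGradedFreeResolution (supportIdeal K M),
      (IsLeast {j | 𝓕.betti 1 j ≠ 0} (generalizedHammingWeight C 1) ↔
        ∃ c ∈ M, wordWeight c = minimumWeight C) ∧
      (IsLeast {j | 𝓕.betti 2 j ≠ 0} (generalizedHammingWeight C 2) ↔ IsD2TestSet C M) := by
  have hne : ∀ σ ∈ supportSet M, σ.Nonempty := by
    rintro _ ⟨c, hc, rfl⟩
    exact wordSupport_nonempty (hM hc).2.1
  have hanti : ∀ σ ∈ supportSet M, ∀ τ ∈ supportSet M, σ ⊆ τ → σ = τ := by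
    rintro _ ⟨c₁, h₁, rfl⟩ _ ⟨c₂, h₂, rfl⟩ h
    exact wordSupport_eq_of_subset_of_mem_minimalSupportCodewords (hM h₁) (hM h₂) h
  refine ⟨⟨minimalGradedFreeResolutionOfIdeal _
    (fun p hp j => homogeneousComponent_mem_squarefreeIdeal hp j)
    (fun p hp => constantCoeff_eq_zero_of_mem_squarefreeIdeal hne hp)⟩, fun 𝓕 => ⟨?_, ?_⟩⟩
  · rw [generalizedHammingWeight_one]
    refine (isLeast_betti_one_squarefreeIdeal_iff hne 𝓕 _).trans ⟨?_, ?_⟩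
    · rintro ⟨⟨_, ⟨c, hc, rfl⟩, hw⟩, -⟩
      exact ⟨c, hc, hw⟩
    · rintro ⟨c, hc, hw⟩
      refine ⟨⟨_, ⟨c, hc, rfl⟩, hw⟩, ?_⟩
      rintro _ ⟨_, ⟨c', hc', rfl⟩, rfl⟩
      exact Nat.sInf_le ⟨c', (hM hc').1, (hM hc').2.1, rfl⟩
  · rw [isD2TestSet_iff hM]
    -- The lower bound d₂ ≤ |σ ∪ τ| always holds, so being least amounts to being attained.
    refine (isLeast_betti_two_squarefreeIdeal_iff hne hanti 𝓕 _).trans ⟨fun h => h.1, fun h => ?_⟩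
    refine ⟨h, ?_⟩
    rintro _ ⟨σ, hσ, τ, hτ, hστ, rfl⟩
    exact generalizedHammingWeight_two_le hM hσ hτ hστ
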